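/- Let $P\subseteq\mathbb{R}^d$ be a full-dimensional lattice polytope with lattice points $\mathscr{A}=P\cap\mathbb{Z}^d=\{m_1,\dots,m_s\}$. Let $n_1,\dots,n_r\in\mathbb{Z}^d$ be the primitive inner normals of the facets of $P$, and $a_1,\dots,a_r\in\mathbb{Z}$ the integers such that the $i$-th facet is $\{p\in P: h_i(p)=0\}$, where $h_i(p)=\langle p,n_i\rangle+a_i\ge 0$ on $P$. For positive real weights $w=(w_1,\dots,w_s)$ put (with $0^0=1$) $$\beta_j(p)=\prod_{i=1}^r h_i(p)^{h_i(m_j)},\qquad \beta_w(p)=\sum_{j=1}^s w_j\beta_j(p),\qquad \overline{w\beta}_{\mathscr{A}}(p)=\Big(\frac{w_1\beta_1(p)}{\beta_w(p)},\dots,\frac{w_s\beta_s(p)}{\beta_w(p)}\Big).$$ $P$ has strict linear precision for $w$ if $p=\frac{1}{\beta_w(p)}\sum_{j=1}^s w_j\beta_j(p)\,m_j$ for all $p\in P$. Let $X_{\mathscr{A},w}\subseteq\mathbb{P}^{s-1}$ be the Zariski closure of $\{[w_1t^{m_1}:\dots:w_st^{m_s}] : t\in(\mathbb{C}^*)^d\}$,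 and let $Y_{\mathscr{A},w}\subseteq(\mathbb{C}^*)^s$ be the image of $\{x\in X_{\mathscr{A},w}: x_1\cdots x_s(x_1+\dots+x_s)\ne0\}$ under $[x_1:\dots:x_s]\mapsto\frac{1}{x_1+\dots+x_s}(x_1,\dots,x_s)$. The ML degree of $Y_{\mathscr{A},w}$ is the number of complex critical points of $\ell_u(x)=x_1^{u_1}\cdots x_s^{u_s}$ on the smooth variety $Y_{\mathscr{A},w}$, for generic $u\in\mathbb{Z}_{>0}^s$. For $u\in\mathbb{R}^s_{>0}$, with $u_+=u_1+\dots+u_s$, the ML estimate $L(u)$ is the point of $Y_{\mathscr{A},w}\cap\mathbb{R}^s_{>0}$ at which $\ell_{u/u_+}$ attains its maximum on $Y_{\mathscr{A},w}\cap\mathbb{R}^s_{>0}$. If $P$ has strict linear precision for $w$, then $Y_{\mathscr{A},w}$ has ML degree one. Moreover, for every $u\in\mathbb{R}^s_{>0}$ the ML estimate exists, is unique, and is given by $$L(u)=\overline{w\beta}_{\mathscr{A}}(\tau_{\mathscr{A}}(u)),\qquad \tau_{\mathscr{A}}(u)=\sum_{j=1}^s\frac{u_j}{u_+}\,m_j .$$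 -/

import Mathlib

namespace ToricML

/-- An integer vector, seen as a real vector. -/
def intVec {d : ℕ} (m : Fin d → ℤ) : Fin d → ℝ := fun k => (m k : ℝ)

/-- A full-dimensional lattice polytope in `ℝ^d`: the convex hull of finitely many points of
`ℤ^d`, with non-empty interior. -/
structure LatticePolytope (d : ℕ) where
  carrier : Set (Fin d → ℝ)
  isLattice : ∃ V : Finset (Fin d → ℤ), carrier = convexHull ℝ (intVec '' (V : Set (Fin d → ℤ)))
  fullDim : (interior carrier).Nonempty

/-- The affine function `h(p) = ⟨p, n⟩ + a` with integer coefficients, over any ring. -/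
def affineForm {R : Type*} [CommRing R] {d : ℕ} (n : Fin d → ℤ) (a : ℤ) (p : Fin d → R) : R :=
  (∑ k, p k * (n k : R)) + (a : R)

namespace LatticePolytope

variable {d : ℕ}

/-- The face of `P` on which `⟨p, n⟩ + a` vanishes. -/
def face (P : LatticePolytope d) (n : Fin d → ℤ) (a : ℤ) : Set (Fin d → ℝ) :=
  {p | p ∈ P.carrier ∧ affineForm n a p = 0}

/-- `(n, a)` is the inner primitive normal and the offset of a facet of `P`: `n` is primitive,
`⟨p, n⟩ + a ≥ 0` on `P`, and equality cuts out a (non-empty) face of dimension `d - 1`. -/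
structure IsFacet (P : LatticePolytope d) (n : Fin d → ℤ) (a : ℤ) : Prop where
  primitive : Finset.univ.gcd n = 1
  nonneg : ∀ p ∈ P.carrier, 0 ≤ affineForm n a p
  nonempty : (P.face n a).Nonempty
  dim : Module.finrank ℝ (vectorSpan ℝ (P.face n a)) + 1 = d

/-- The facets of `P`, each given by its primitive inner normal `n_i` and its offset `a_i`. -/
def Facet (P : LatticePolytope d) : Type := {f : (Fin d → ℤ) × ℤ // P.IsFacet f.1 f.2}

/-- The index set `𝒜 = P ∩ ℤ^d` of the lattice points of `P`. -/
def LatticePoint (P : LatticePolytope d) : Type := {m : Fin d → ℤ // intVec m ∈ P.carrier}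

/-! Finiteness of the sets of lattice points and of facets. -/

theorem finite_latticePoint (P : LatticePolytope d) : Finite P.LatticePoint := by
  obtain ⟨V, hV⟩ := P.isLattice
  have hb : Bornology.IsBounded P.carrier := by
    rw [hV, isBounded_convexHull]
    exact (V.finite_toSet.image _).isBounded
  obtain ⟨r, hr⟩ := hb.subset_closedBall 0
  refine Set.Finite.subset (Set.finite_Icc (fun _ : Fin d => -⌈r⌉) (fun _ => ⌈r⌉)) ?_
  intro m hm
  have h1 := hr hm
  rw [mem_closedBall_zero_iff] at h1
  have h2 : ∀ k, |m k| ≤ ⌈r⌉ := by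
    intro k
    have h3 : ‖intVec m k‖ ≤ r := (norm_le_pi_norm _ k).trans h1
    have h4 : ((|m k| : ℤ) : ℝ) ≤ (⌈r⌉ : ℝ) := by
      rw [Int.cast_abs]
      exact h3.trans (Int.le_ceil r)
    exact_mod_cast h4
  exact ⟨fun k => (abs_le.mp (h2 k)).1, fun k => (abs_le.mp (h2 k)).2⟩

/-- The linear part of `affineForm`, as a linear functional on `ℝ^d`. -/
def linPart (n : Fin d → ℤ) : (Fin d → ℝ) →ₗ[ℝ] ℝ := ∑ k, (n k : ℝ) • LinearMap.proj k

theorem affineForm_eq (n : Fin d → ℤ) (a : ℤ) (p : Fin d → ℝ) :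
    affineForm n a p = linPart n p + a := by
  simp [affineForm, linPart, mul_comm]

theorem IsFacet.linPart_ne_zero {P : LatticePolytope d} {n : Fin d → ℤ} {a : ℤ}
    (h : P.IsFacet n a) : linPart n ≠ 0 := by
  intro h0
  have hn : ∀ k ∈ Finset.univ, n k = 0 := by
    intro k _
    have := congrArg (fun L : (Fin d → ℝ) →ₗ[ℝ] ℝ => L (Pi.single k 1)) h0
    simpa [linPart, Pi.single_apply] using this
  have h1 := h.primitive
  rw [Finset.gcd_eq_zero_iff.mpr hn] at h1
  exact zero_ne_one h1

theorem IsFacet.vectorSpan_eq {P : LatticePolytope d} {n : Fin d → ℤ} {a : ℤ}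
    (h : P.IsFacet n a) : vectorSpan ℝ (P.face n a) = LinearMap.ker (linPart n) := by
  refine Submodule.eq_of_le_of_finrank_eq ?_ ?_
  · rw [vectorSpan_def, Submodule.span_le]
    rintro _ ⟨p, hp, q, hq, rfl⟩
    have h1 := hp.2
    have h2 := hq.2
    rw [affineForm_eq] at h1 h2
    simp only [vsub_eq_sub, SetLike.mem_coe, LinearMap.mem_ker, map_sub]
    linarith
  · have h1 := h.dim
    have h2 := Module.Dual.finrank_ker_add_one_of_ne_zero h.linPart_ne_zero
    rw [Module.finrank_fin_fun] at h2
    omega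

theorem IsFacet.exists_pos {P : LatticePolytope d} {n : Fin d → ℤ} {a : ℤ}
    (h : P.IsFacet n a) : ∃ p ∈ P.carrier, 0 < affineForm n a p := by
  by_contra! hc
  have h1 : P.face n a = P.carrier := by
    ext p
    exact ⟨fun hp => hp.1, fun hp => ⟨hp, le_antisymm (hc p hp) (h.nonneg p hp)⟩⟩
  have h2 : vectorSpan ℝ P.carrier = ⊤ := by
    rw [← direction_affineSpan, top_unique ((isOpen_interior.affineSpan_eq_top P.fullDim).symm.le.trans
      (affineSpan_mono ℝ interior_subset)), AffineSubspace.direction_top]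
  have h3 := h.dim
  rw [h1, h2, finrank_top, Module.finrank_fin_fun] at h3
  omega

/-- A facet determines its normal and its offset. -/
theorem eq_of_face_eq (P : LatticePolytope d) {n n' : Fin d → ℤ} {a a' : ℤ}
    (h : P.IsFacet n a) (h' : P.IsFacet n' a') (hf : P.face n a = P.face n' a') :
    n = n' ∧ a = a' := by
  obtain ⟨q, hq⟩ := h.nonempty
  have hq1 := hq.2
  have hq2 := (hf ▸ hq : q ∈ P.face n' a').2
  rw [affineForm_eq] at hq1 hq2
  have hk : LinearMap.ker (linPart n) = LinearMap.ker (linPart n') := by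
    rw [← h.vectorSpan_eq, ← h'.vectorSpan_eq, hf]
  obtain ⟨c, hc⟩ : ∃ c : ℝ, c • linPart n = linPart n' := by
    refine Submodule.mem_span_singleton.mp ?_
    have := mem_span_of_iInf_ker_le_ker (ι := Unit) (L := fun _ => linPart n) (K := linPart n')
      (by simp [hk])
    simpa using this
  have hc' : ∀ p, linPart n' p = c * linPart n p := fun p => by rw [← hc]; rfl
  have hcoord : ∀ k, (n' k : ℝ) = c * n k := by
    intro k
    simpa [linPart, Pi.single_apply] using hc' (Pi.single k 1)
  have hc0 : c ≠ 0 := by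
    rintro rfl
    exact h'.linPart_ne_zero (by rw [← hc, zero_smul])
  have hcpos : 0 < c := by
    obtain ⟨p, hp, hp0⟩ := h.exists_pos
    have h1 := h'.nonneg p hp
    rw [affineForm_eq] at hp0 h1
    have h2 := hc' p
    have h3 := hc' q
    refine lt_of_le_of_ne ?_ hc0.symm
    by_contra! hneg
    nlinarith
  have hn : n = n' := by
    obtain ⟨k, hk0⟩ : ∃ k, n k ≠ 0 := by
      by_contra! h0
      exact h.linPart_ne_zero (by ext; simp [linPart, h0])
    have hcross : ∀ l, n k * n' l = n' k * n l := by
      intro l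
      have : (n k : ℝ) * n' l = n' k * n l := by rw [hcoord l, hcoord k]; ring
      exact_mod_cast this
    have hg : normalize (n k) = normalize (n' k) := by
      have h1 := Finset.gcd_mul_left (s := Finset.univ) (f := n') (a := n k)
      have h2 := Finset.gcd_mul_left (s := Finset.univ) (f := n) (a := n' k)
      rw [h.primitive, mul_one] at h2
      rw [h'.primitive, mul_one] at h1
      rw [← h1, ← h2]
      exact Finset.gcd_congr rfl fun l _ => hcross l
    have hkk : n k = n' k := by
      rw [← Int.abs_eq_normalize, ← Int.abs_eq_normalize] at hg
      rcases abs_eq_abs.mp hg with h1 | h1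
      · exact h1
      · exfalso
        have h2 := hcoord k
        have h3 : (n k : ℝ) = -(n' k : ℝ) := by exact_mod_cast h1
        have h4 : (1 + c) * (n k : ℝ) = 0 := by linear_combination h3 - h2
        rcases mul_eq_zero.mp h4 with h5 | h5
        · linarith
        · exact hk0 (by exact_mod_cast h5)
    funext l
    have := hcross l
    rw [← hkk] at this
    exact (mul_left_cancel₀ hk0 this).symm
  subst hn
  refine ⟨rfl, ?_⟩
  have : (a : ℝ) = a' := by linarith
  exact_mod_cast this

theorem face_eq_convexHull (P : LatticePolytope d) (V : Finset (Fin d → ℤ))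
    (hV : P.carrier = convexHull ℝ (intVec '' (V : Set (Fin d → ℤ)))) {n : Fin d → ℤ} {a : ℤ}
    (h : ∀ p ∈ P.carrier, 0 ≤ affineForm n a p) :
    P.face n a = convexHull ℝ (intVec '' {m | m ∈ V ∧ affineForm n a (intVec m) = 0}) := by
  classical
  have hmem : ∀ m ∈ V, intVec m ∈ P.carrier := fun m hm => by
    rw [hV]; exact subset_convexHull ℝ _ ⟨m, hm, rfl⟩
  apply Set.Subset.antisymm
  · rintro p ⟨hp, hp0⟩
    rw [hV, ← Finset.coe_image, Finset.mem_convexHull'] at hp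
    obtain ⟨c, hc0, hc1, rfl⟩ := hp
    have hsum : ∑ y ∈ V.image intVec, c y * affineForm n a y = 0 := by
      rw [← hp0, affineForm_eq, map_sum]
      simp only [affineForm_eq, mul_add, Finset.sum_add_distrib, ← Finset.sum_mul, hc1, one_mul,
        map_smul, smul_eq_mul]
    have hz : ∀ y ∈ V.image intVec, c y * affineForm n a y = 0 := by
      refine (Finset.sum_eq_zero_iff_of_nonneg ?_).mp hsum
      intro y hy
      obtain ⟨m, hm, rfl⟩ := Finset.mem_image.mp hy
      exact mul_nonneg (hc0 _ hy) (h _ (hmem m hm))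
    have hS : ((V.image intVec).filter (fun y => affineForm n a y = 0) : Set (Fin d → ℝ)) =
        intVec '' {m | m ∈ V ∧ affineForm n a (intVec m) = 0} := by
      ext y
      simp only [Finset.coe_filter, Finset.mem_image]
      constructor
      · rintro ⟨⟨m, hm, rfl⟩, h0⟩
        exact ⟨m, ⟨hm, h0⟩, rfl⟩
      · rintro ⟨m, ⟨hm, h0⟩, rfl⟩
        exact ⟨⟨m, hm, rfl⟩, h0⟩
    rw [← hS, Finset.mem_convexHull']
    have hz' : ∀ y ∈ V.image intVec, c y ≠ 0 → affineForm n a y = 0 := fun y hy hne =>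
      (mul_eq_zero.mp (hz y hy)).resolve_left hne
    refine ⟨c, fun y hy => hc0 y (Finset.mem_filter.mp hy).1, ?_, ?_⟩
    · rw [← hc1]
      exact Finset.sum_filter_of_ne hz'
    · exact Finset.sum_filter_of_ne fun y hy hne => hz' y hy fun h0 => hne (by rw [h0, zero_smul])
  · refine convexHull_min ?_ ?_
    · rintro _ ⟨m, ⟨hm, h0⟩, rfl⟩
      exact ⟨hmem m hm, h0⟩
    · have hconv : Convex ℝ P.carrier := by rw [hV]; exact convex_convexHull ℝ _
      intro x hx y hy s t hs ht hst
      refine ⟨hconv hx.1 hy.1 hs ht hst, ?_⟩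
      have h1 := hx.2
      have h2 := hy.2
      rw [affineForm_eq] at h1 h2 ⊢
      simp only [map_add, map_smul, smul_eq_mul]
      linear_combination s * h1 + t * h2 - (a : ℝ) * hst

theorem finite_facet (P : LatticePolytope d) : Finite P.Facet := by
  classical
  obtain ⟨V, hV⟩ := P.isLattice
  refine Finite.of_injective (β := V.powerset) (fun f : P.Facet =>
    ⟨V.filter (fun m => affineForm f.1.1 f.1.2 (intVec m) = 0),
      Finset.mem_powerset.mpr (Finset.filter_subset _ _)⟩) ?_
  intro f g hfg
  have h1 := congrArg (fun s : V.powerset => (s.1 : Set (Fin d → ℤ))) hfg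
  simp only [Finset.coe_filter] at h1
  have h2 : P.face f.1.1 f.1.2 = P.face g.1.1 g.1.2 := by
    rw [P.face_eq_convexHull V hV f.2.nonneg, P.face_eq_convexHull V hV g.2.nonneg, h1]
  have h3 := P.eq_of_face_eq f.2 g.2 h2
  exact Subtype.ext (Prod.ext h3.1 h3.2)

noncomputable instance (P : LatticePolytope d) : Fintype P.LatticePoint :=
  @Fintype.ofFinite _ P.finite_latticePoint

noncomputable instance (P : LatticePolytope d) : Fintype P.Facet :=
  @Fintype.ofFinite _ P.finite_facet

/-- The lattice distance `h_i(p) = ⟨p, n_i⟩ + a_i` to the `i`-th facet. -/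
def Facet.h {R : Type*} [CommRing R] {P : LatticePolytope d} (f : P.Facet) (p : Fin d → R) : R :=
  affineForm f.1.1 f.1.2 p

/-- `β_m(p) = ∏ i, h_i(p) ^ h_i(m)`. The exponents are non-negative integers because `m ∈ P`;
in Lean `0 ^ 0 = 1`. -/
noncomputable def beta {R : Type*} [CommRing R] (P : LatticePolytope d) (m : P.LatticePoint)
    (p : Fin d → R) : R :=
  ∏ f : P.Facet, f.h p ^ (f.h m.1).toNat

/-- `β_w(p) = ∑ m, w_m β_m(p)`, on `ℝ^d` and on `ℂ^d`. -/
noncomputable def betaW {𝕜 : Type*} [RCLike 𝕜] (P : LatticePolytope d) (w : P.LatticePoint → ℝ)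
    (p : Fin d → 𝕜) : 𝕜 :=
  ∑ m, (w m : 𝕜) * P.beta m p

/-- The toric blending parametrization `p ↦ (w_m β_m(p) / β_w(p))_m`, on `ℝ^d` and on `ℂ^d`. -/
noncomputable def toricBlending {𝕜 : Type*} [RCLike 𝕜] (P : LatticePolytope d)
    (w : P.LatticePoint → ℝ) (p : Fin d → 𝕜) : P.LatticePoint → 𝕜 :=
  fun m => (w m : 𝕜) * P.beta m p / P.betaW w p

/-- The map `K_w(p) = β_w(p)⁻¹ ∑ m, w_m β_m(p) m`. -/
noncomputable def krasauskasMap (P : LatticePolytope d) (w : P.LatticePoint → ℝ)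
    (p : Fin d → ℝ) : Fin d → ℝ :=
  (P.betaW w p)⁻¹ • ∑ m : P.LatticePoint, (w m * P.beta m p) • intVec m.1

/-- `P` has strict linear precision for the weights `w`: `K_w` is the identity on `P`. -/
def StrictLinearPrecision (P : LatticePolytope d) (w : P.LatticePoint → ℝ) : Prop :=
  ∀ p ∈ P.carrier, P.krasauskasMap w p = p

/-- The map `τ_𝒜(x) = ∑ m, (x_m / x_+) m`, where `x_+ = ∑ m, x_m`. -/
noncomputable def tau (P : LatticePolytope d) (x : P.LatticePoint → ℝ) : Fin d → ℝ :=
  ∑ m : P.LatticePoint, (x m / ∑ m', x m') • intVec m.1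

/-- The weighted monomial vector `(w_m t^m)_m` of a point `t` of the torus `(ℂ^*)^d`. -/
noncomputable def monomialVec (P : LatticePolytope d) (w : P.LatticePoint → ℝ)
    (t : Fin d → ℂˣ) : P.LatticePoint → ℂ :=
  fun m => (w m : ℂ) * ∏ k, (t k : ℂ) ^ (m.1 k)

/-- The image of `(ℂ^*)^d` in projective space under `t ↦ [w_m t^m]_m`. -/
def torusImage (P : LatticePolytope d) (w : P.LatticePoint → ℝ) :
    Set (Projectivization ℂ (P.LatticePoint → ℂ)) :=
  {q | ∃ (t : Fin d → ℂˣ) (h : P.monomialVec w t ≠ 0), q = Projectivization.mk ℂ _ h}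

end LatticePolytope

/-- The Zariski closure of a subset of complex projective space: the common zeros of all
homogeneous polynomials that vanish on it. -/
def projZariskiClosure {ι : Type*} (S : Set (Projectivization ℂ (ι → ℂ))) :
    Set (Projectivization ℂ (ι → ℂ)) :=
  {q | ∀ (N : ℕ) (F : MvPolynomial ι ℂ), F.IsHomogeneous N →
    (∀ x ∈ S, MvPolynomial.eval x.rep F = 0) → MvPolynomial.eval q.rep F = 0}

namespace LatticePolytope

variable {d : ℕ}

/-- The scaled projective toric variety `X_{𝒜,w}`. -/
def projToric (P : LatticePolytope d) (w : P.LatticePoint → ℝ) :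
    Set (Projectivization ℂ (P.LatticePoint → ℂ)) :=
  projZariskiClosure (P.torusImage w)

/-- The scaled very affine toric variety `Y_{𝒜,w}`: the image of the part of `X_{𝒜,w}` on which
no coordinate and not the sum of the coordinates vanishes, under `[x] ↦ x / x_+`. -/
def veryAffineToric (P : LatticePolytope d) (w : P.LatticePoint → ℝ) :
    Set (P.LatticePoint → ℂ) :=
  {y | ∃ q ∈ P.projToric w, (∀ m, q.rep m ≠ 0) ∧ (∑ m, q.rep m) ≠ 0 ∧
    y = fun m => q.rep m / ∑ m', q.rep m'}

end LatticePolytope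

section MaximumLikelihood

variable {ι : Type*} [Fintype ι]

/-- The differential of the polynomial `F` at `y`, applied to `v`. -/
noncomputable def polyDifferential (F : MvPolynomial ι ℂ) (y v : ι → ℂ) : ℂ :=
  ∑ j, MvPolynomial.eval y (MvPolynomial.pderiv j F) * v j

/-- `v` lies in the Zariski tangent space of `Y` at `y`: the differentials at `y` of all
polynomials that vanish on `Y` vanish on `v`. -/
def IsTangent (Y : Set (ι → ℂ)) (y v : ι → ℂ) : Prop :=
  ∀ F : MvPolynomial ι ℂ, (∀ z ∈ Y, MvPolynomial.eval z F = 0) → polyDifferential F y v = 0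

/-- `y` is a critical point of the restriction to `Y` of `ℓ_u(x) = ∏ j, x_j ^ u_j`
(for a smooth very affine variety `Y`): the differential of `ℓ_u` vanishes on the tangent
space of `Y` at `y`. -/
def IsCriticalPoint (Y : Set (ι → ℂ)) (u : ι → ℕ) (y : ι → ℂ) : Prop :=
  y ∈ Y ∧ ∀ v, IsTangent Y y v → polyDifferential (∏ j, MvPolynomial.X j ^ u j) y v = 0

/-- The smooth very affine variety `Y` has maximum likelihood degree `n`: for generic
`u ∈ ℤ_{>0}^s`, that is, off the zero set of some non-zero polynomial, `ℓ_u` has exactly `n`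
complex critical points on `Y`. -/
def HasMLDegree (Y : Set (ι → ℂ)) (n : ℕ) : Prop :=
  ∃ G : MvPolynomial ι ℂ, G ≠ 0 ∧ ∀ u : ι → ℕ, (∀ j, 0 < u j) →
    MvPolynomial.eval (fun j => (u j : ℂ)) G ≠ 0 → {y | IsCriticalPoint Y u y}.encard = n

/-- The statistical model `Y ∩ ℝ_{>0}^s`. -/
def positivePart (Y : Set (ι → ℂ)) : Set (ι → ℝ) :=
  {x | (∀ j, 0 < x j) ∧ (fun j => (x j : ℂ)) ∈ Y}

/-- The likelihood function `ℓ_u(x) = ∏ j, x_j ^ u_j` for real exponents `u`. -/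
noncomputable def likelihood (u x : ι → ℝ) : ℝ := ∏ j, x j ^ u j

/-- `x` is a maximum likelihood estimate of the (not necessarily normalized) data `u`: a point of
`Y ∩ ℝ_{>0}^s` at which the likelihood function of `u / u_+` attains its maximum there. -/
def IsMLEstimate (Y : Set (ι → ℂ)) (u x : ι → ℝ) : Prop :=
  x ∈ positivePart Y ∧
    ∀ z ∈ positivePart Y,
      likelihood (fun j => u j / ∑ j', u j') z ≤ likelihood (fun j => u j / ∑ j', u j') x

end MaximumLikelihood

end ToricML

/-! Write c(y) = ∑ y_m m for the center of a point y with coordinate sum one. The proof rests on the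
blending equations y_m β_w(c(y)) = w_m β_m(c(y)), which hold on all of Y. Where β_w(c(y)) ≠ 0, they
determine y from c(y).

To obtain them, observe that the vector (β_m(p))_m is proportional to the monomial vector (t^m)_m at
the torus point t(p) with coordinates ∏ h_i(p)^{n_ik}. By linear precision the weighted moment map
inverts p ↦ t(p) from the left, so t(p) fills an open set of the real torus (`map_torusPoint_nhds`).
There the homogenized equations hold, again by precision; an open set of the real torus is Zariski
dense in the complex torus, so they hold on X (`eval_blendingForm_monomialVec`, `mul_betaW_center`).

A critical point of ℓ_u is orthogonal to the torus directions, which forces c(y) = c(u/u_+), a real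
point off all facets; the blending equations then leave one candidate. Conversely, differentiating
the blending equations shows that v_m / y_m is an affine function of m for every tangent vector v at
the candidate (`exists_affine_of_isTangent`). Averages of affine functions depend only on the
center, so ∑ u_m v_m / y_m = u_+ ∑ v_m = 0.

The maximum is found in the same way. For a positive z on Y and the candidate x, log z_m - log x_m
is affine in m, so its average for u/u_+ equals its average for x, which is negative by Gibbs'
inequality unless z = x (`sum_mul_log_lt`). -/

namespace ToricML

/-! ### Homogeneous scaling and differentials of polynomials along curves -/

section Polynomials

open MvPolynomial

theorem eval_smul_of_isHomogeneous {ι R : Type*} [CommRing R] {F : MvPolynomial ι R} {N : ℕ}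
    (hF : F.IsHomogeneous N) (a : R) (x : ι → R) : eval (a • x) F = a ^ N * eval x F := by
  simp only [eval_eq, Finset.mul_sum]
  refine Finset.sum_congr rfl fun e he => ?_
  have hN : ∑ i ∈ e.support, e i = N := by
    rw [← hF (mem_support_iff.mp he), Finsupp.weight_apply, Finsupp.sum]
    simp
  simp only [Pi.smul_apply, smul_eq_mul, mul_pow, Finset.prod_mul_distrib]
  rw [Finset.prod_pow_eq_pow_sum, hN]
  ring

variable {ι : Type*} [Fintype ι]

/-- The differential of a polynomial computes derivatives along curves. -/
theorem hasDerivAt_eval_comp (F : MvPolynomial ι ℂ) {c : ℂ → ι → ℂ} {v : ι → ℂ} {s : ℂ}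
    (hc : ∀ j, HasDerivAt (fun s => c s j) (v j) s) :
    HasDerivAt (fun s => eval (c s) F) (polyDifferential F (c s) v) s := by
  classical
  induction F using MvPolynomial.induction_on with
  | C a => simpa [polyDifferential] using hasDerivAt_const s a
  | add p q hp hq =>
    have := hp.fun_add hq
    simpa [polyDifferential, add_mul, Finset.sum_add_distrib] using this
  | mul_X p i hp =>
    have := hp.fun_mul (hc i)
    have h1 : (fun s => eval (c s) (p * X i)) = fun s => eval (c s) p * c s i := by
      ext
      simp
    rw [h1]
    refine this.congr_deriv ?_
    simp only [polyDifferential, Derivation.leibniz, pderiv_X, smul_eq_mul, map_add, map_mul,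
      eval_X, add_mul, Finset.sum_add_distrib, Finset.sum_mul]
    rw [add_comm]
    congr 1
    · rw [Finset.sum_eq_single i]
      · simp
      · intro j _ hj
        simp [hj.symm]
      · simp
    · exact Finset.sum_congr rfl fun j _ => by ring

/-- Logarithmic differentiation of a product of powers. -/
theorem hasDerivAt_prod_pow {κ : Type*} (S : Finset κ) {f : κ → ℂ → ℂ} {g : κ → ℂ} {s : ℂ}
    (e : κ → ℕ) (hf : ∀ j ∈ S, HasDerivAt (f j) (f j s * g j) s) :
    HasDerivAt (fun s => ∏ j ∈ S, f j s ^ e j)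
      ((∏ j ∈ S, f j s ^ e j) * ∑ j ∈ S, e j * g j) s := by
  classical
  induction S using Finset.induction_on with
  | empty => simpa using hasDerivAt_const s (1 : ℂ)
  | insert a S ha ih =>
    have h1 := ih fun j hj => hf j (Finset.mem_insert_of_mem hj)
    have h2 := (hf a (Finset.mem_insert_self a S)).fun_pow (e a)
    have h3 := h2.fun_mul h1
    simp only [Finset.prod_insert ha, Finset.sum_insert ha]
    refine h3.congr_deriv ?_
    -- The power rule contains the truncated exponent `e a - 1`, so the exponent zero is treated
    -- separately.
    rcases Nat.eq_zero_or_pos (e a) with h0 | h0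
    · simp [h0]
    · obtain ⟨n, hn⟩ := Nat.exists_eq_succ_of_ne_zero h0.ne'
      simp only [hn, Nat.succ_eq_add_one, Nat.add_sub_cancel, pow_succ]
      push_cast
      ring

/-- An equation of Y is locally constant zero along a curve in Y, so the chain rule kills its
differential on the velocity. This produces tangent vectors without any knowledge of the ideal of Y.
-/
theorem isTangent_of_hasDerivAt {Y : Set (ι → ℂ)} {c : ℂ → ι → ℂ} {v : ι → ℂ} {s : ℂ}
    (hc : ∀ j, HasDerivAt (fun s => c s j) (v j) s) (hY : ∀ᶠ r in nhds s, c r ∈ Y) :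
    IsTangent Y (c s) v := by
  intro F hF
  have h1 := hasDerivAt_eval_comp F hc
  have h2 : (fun s => eval (c s) F) =ᶠ[nhds s] fun _ => 0 := hY.mono fun r hr => hF _ hr
  exact (h1.congr_of_eventuallyEq h2.symm).unique (hasDerivAt_const s (0 : ℂ))

theorem polyDifferential_monomial (u : ι → ℕ) {y : ι → ℂ} (hy : ∀ j, y j ≠ 0) (v : ι → ℂ) :
    polyDifferential (∏ j, X j ^ u j) y v = (∏ j, y j ^ u j) * ∑ j, u j * (v j / y j) := by
  have hc : ∀ j, HasDerivAt (fun s : ℂ => (y + s • v) j) (v j) 0 := fun j => by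
    simpa using ((hasDerivAt_id (0 : ℂ)).mul_const (v j)).const_add (y j)
  have h1 := hasDerivAt_eval_comp (∏ j, X j ^ u j) (c := fun s => y + s • v) hc
  have h2 := hasDerivAt_prod_pow Finset.univ (f := fun j s => (y + s • v) j)
    (g := fun j => v j / y j) (s := 0) u fun j _ => by
      refine (hc j).congr_deriv ?_
      have := hy j
      simp
      field_simp
  simp only [map_prod, map_pow, eval_X] at h1
  simpa using h1.unique h2

end Polynomials

/-! ### The very affine toric variety, the torus action and Zariski density of real points -/

namespace LatticePolytope

open MvPolynomial

variable {d : ℕ} (P : LatticePolytope d) (w : P.LatticePoint → ℝ)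

theorem monomialVec_ne_zero {w : P.LatticePoint → ℝ} (hw : ∀ m, 0 < w m) (t : Fin d → ℂˣ)
    (m : P.LatticePoint) : P.monomialVec w t m ≠ 0 :=
  mul_ne_zero (by exact_mod_cast (hw m).ne')
    (Finset.prod_ne_zero_iff.mpr fun k _ => zpow_ne_zero _ (t k).ne_zero)

theorem rep_mk_eq_smul {ι : Type*} {x : ι → ℂ} (hx : x ≠ 0) :
    ∃ a : ℂ, a ≠ 0 ∧ (Projectivization.mk ℂ x hx).rep = a • x := by
  obtain ⟨a, ha⟩ := Projectivization.exists_smul_eq_mk_rep ℂ x hx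
  exact ⟨a, a.ne_zero, ha.symm⟩

/-- The very affine toric variety in terms of homogeneous equations of the torus. -/
theorem mem_veryAffineToric_iff {w : P.LatticePoint → ℝ} (hw : ∀ m, 0 < w m)
    {y : P.LatticePoint → ℂ} :
    y ∈ P.veryAffineToric w ↔ (∀ m, y m ≠ 0) ∧ ∑ m, y m = 1 ∧
      ∀ (N : ℕ) (F : MvPolynomial P.LatticePoint ℂ), F.IsHomogeneous N →
        (∀ t, eval (P.monomialVec w t) F = 0) → eval y F = 0 := by
  constructor
  · rintro ⟨q, hq, hne, hS, rfl⟩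
    refine ⟨fun m => div_ne_zero (hne m) hS, by rw [← Finset.sum_div, div_self hS], ?_⟩
    intro N F hF hv
    have h1 : eval q.rep F = 0 := by
      refine hq N F hF ?_
      rintro _ ⟨t, ht, rfl⟩
      obtain ⟨a, -, h2⟩ := rep_mk_eq_smul ht
      rw [h2, eval_smul_of_isHomogeneous hF, hv, mul_zero]
    have h2 : (fun m => q.rep m / ∑ m', q.rep m') = (∑ m', q.rep m')⁻¹ • q.rep := by
      ext m
      simp [div_eq_inv_mul]
    rw [h2, eval_smul_of_isHomogeneous hF, h1, mul_zero]
  · rintro ⟨hne, hS, hv⟩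
    have hy : y ≠ 0 := by
      rintro rfl
      simp at hS
    obtain ⟨a, ha, h2⟩ := rep_mk_eq_smul hy
    have hsum : ∑ m, (Projectivization.mk ℂ y hy).rep m = a := by
      rw [h2]
      simp [← Finset.mul_sum, hS]
    refine ⟨Projectivization.mk ℂ y hy, ?_, ?_, by rwa [hsum], ?_⟩
    · intro N F hF hT
      rw [h2, eval_smul_of_isHomogeneous hF, hv N F hF, mul_zero]
      intro t
      have hm : P.monomialVec w t ≠ 0 := by
        obtain ⟨m, -⟩ := Function.ne_iff.mp hy
        exact fun h => P.monomialVec_ne_zero hw t m (congrFun h m)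
      obtain ⟨b, hb, h3⟩ := rep_mk_eq_smul hm
      have h4 := hT _ ⟨t, hm, rfl⟩
      rw [h3, eval_smul_of_isHomogeneous hF] at h4
      exact (mul_eq_zero.mp h4).resolve_left (pow_ne_zero _ hb)
    · intro m
      rw [h2]
      exact mul_ne_zero ha (hne m)
    · ext m
      rw [hsum, h2]
      simp [ha]

/-- Normalizing a torus point to coordinate sum one gives a point of the very affine variety. -/
theorem mem_veryAffineToric_of_smul_monomialVec {w : P.LatticePoint → ℝ} (hw : ∀ m, 0 < w m)
    {y : P.LatticePoint → ℂ} (hS : ∑ m, y m = 1) {a : ℂ} (ha : a ≠ 0) {t : Fin d → ℂˣ}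
    (h : y = a • P.monomialVec w t) : y ∈ P.veryAffineToric w := by
  rw [P.mem_veryAffineToric_iff hw]
  refine ⟨fun m => ?_, hS, fun N F hF hv => ?_⟩
  · rw [h]
    exact mul_ne_zero ha (P.monomialVec_ne_zero hw t m)
  · rw [h, eval_smul_of_isHomogeneous hF, hv, mul_zero]

/-- The very affine toric variety is stable under the torus action. -/
theorem torus_smul_mem_veryAffineToric {w : P.LatticePoint → ℝ} (hw : ∀ m, 0 < w m)
    {y : P.LatticePoint → ℂ} (hy : y ∈ P.veryAffineToric w) (k : Fin d) (t : ℂˣ)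
    (hS : ∑ m : P.LatticePoint, y m * (t : ℂ) ^ (m.1 k) ≠ 0) :
    (fun m : P.LatticePoint =>
      y m * (t : ℂ) ^ (m.1 k) / ∑ m' : P.LatticePoint, y m' * (t : ℂ) ^ (m'.1 k)) ∈
      P.veryAffineToric w := by
  rw [P.mem_veryAffineToric_iff hw] at hy ⊢
  obtain ⟨hne, -, hv⟩ := hy
  refine ⟨fun m => div_ne_zero (mul_ne_zero (hne m) (zpow_ne_zero _ t.ne_zero)) hS,
    by rw [← Finset.sum_div, div_self hS], fun N F hF hT => ?_⟩
  have h2 : (fun m : P.LatticePoint =>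
      y m * (t : ℂ) ^ (m.1 k) / ∑ m' : P.LatticePoint, y m' * (t : ℂ) ^ (m'.1 k)) =
      (∑ m' : P.LatticePoint, y m' * (t : ℂ) ^ (m'.1 k))⁻¹ •
        fun m : P.LatticePoint => y m * (t : ℂ) ^ (m.1 k) := by
    ext m
    simp [div_eq_inv_mul]
  rw [h2, eval_smul_of_isHomogeneous hF]
  -- Pull the form back along the torus element: the result is again homogeneous of degree `N` and
  -- vanishes on the torus image, because that image is stable under the action.
  have hev : ∀ x : P.LatticePoint → ℂ,
      eval x (bind₁ (fun m : P.LatticePoint => C ((t : ℂ) ^ (m.1 k)) * X m) F) =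
        eval (fun m : P.LatticePoint => x m * (t : ℂ) ^ (m.1 k)) F := by
    intro x
    change eval₂Hom (RingHom.id ℂ) x _ = _
    rw [eval₂Hom_bind₁]
    congr 2
    ext m
    simp [mul_comm]
  have hhom : (bind₁ (fun m : P.LatticePoint => C ((t : ℂ) ^ (m.1 k)) * X m) F).IsHomogeneous
      N := by
    have := hF.aeval (fun m : P.LatticePoint => C ((t : ℂ) ^ (m.1 k)) * X m) (n := 1)
      fun m => (isHomogeneous_C_mul_X _ m)
    rwa [one_mul] at this
  rw [← hev, hv N _ hhom, mul_zero]
  intro s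
  rw [hev]
  have h3 : (fun m : P.LatticePoint => P.monomialVec w s m * (t : ℂ) ^ (m.1 k)) =
      P.monomialVec w (Function.update s k (s k * t)) := by
    ext m
    simp only [monomialVec]
    have : ∀ l, ((Function.update s k (s k * t) l : ℂˣ) : ℂ) ^ m.1 l =
        (s l : ℂ) ^ m.1 l * if l = k then (t : ℂ) ^ m.1 k else 1 := by
      intro l
      by_cases hl : l = k
      · subst hl
        simp [mul_zpow]
      · simp [hl]
    simp only [this, Finset.prod_mul_distrib, Finset.prod_ite_eq', Finset.mem_univ, if_true]
    ring
  rw [h3, hT]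

/-- A homogeneous form that vanishes on the image of an open set of real torus points vanishes on
the image of the whole complex torus. -/
theorem eval_monomialVec_eq_zero_of_real {F : MvPolynomial P.LatticePoint ℂ} {N : ℕ}
    (hF : F.IsHomogeneous N) {t₀ : Fin d → ℝ} (h : ∀ᶠ t in nhds t₀, (∀ k, t k ≠ 0) ∧
      eval (fun m : P.LatticePoint => (w m : ℂ) * ∏ k, (t k : ℂ) ^ (m.1 k)) F = 0)
    (t : Fin d → ℂˣ) : eval (P.monomialVec w t) F = 0 := by
  -- Lattice points may have negative coordinates. Multiplying every monomial by (∏ t_k)^M clears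
  -- the denominators, and homogeneity turns this common factor into a nonzero scalar.
  obtain ⟨M, hM⟩ : ∃ M : ℕ, ∀ (m : P.LatticePoint) k, 0 ≤ m.1 k + M := by
    refine ⟨∑ m : P.LatticePoint, ∑ k, (m.1 k).natAbs, fun m k => ?_⟩
    have h1 : (m.1 k).natAbs ≤ ∑ m : P.LatticePoint, ∑ k, (m.1 k).natAbs :=
      (Finset.single_le_sum (f := fun k => (m.1 k).natAbs) (fun _ _ => Nat.zero_le _)
        (Finset.mem_univ k)).trans
      (Finset.single_le_sum (f := fun m : P.LatticePoint => ∑ k, (m.1 k).natAbs)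
        (fun _ _ => Nat.zero_le _) (Finset.mem_univ m))
    omega
  set G : MvPolynomial (Fin d) ℂ :=
    bind₁ (fun m : P.LatticePoint => C (w m : ℂ) * ∏ k, X k ^ (m.1 k + M).toNat) F with hG
  have hev : ∀ t : Fin d → ℂ, (∀ k, t k ≠ 0) → eval t G =
      ((∏ k, t k) ^ M) ^ N *
        eval (fun m : P.LatticePoint => (w m : ℂ) * ∏ k, t k ^ (m.1 k)) F := by
    intro t ht
    rw [← eval_smul_of_isHomogeneous hF, hG]
    change eval₂Hom (RingHom.id ℂ) t _ = _
    rw [eval₂Hom_bind₁]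
    congr 2
    ext m
    have : ∀ k, t k ^ (m.1 k + M).toNat = t k ^ M * t k ^ m.1 k := by
      intro k
      rw [← zpow_natCast, Int.toNat_of_nonneg (hM m k), zpow_add₀ (ht k), zpow_natCast, mul_comm]
    simp only [coe_eval₂Hom, eval₂_mul, eval₂_C, RingHom.id_apply, eval₂_prod, eval₂_pow, eval₂_X,
      this, Finset.prod_mul_distrib, Finset.prod_pow, Pi.smul_apply, smul_eq_mul]
    ring
  have hG0 : G = 0 := by
    obtain ⟨ε, hε, hball⟩ := Metric.eventually_nhds_iff_ball.mp h
    -- A polynomial that vanishes on a product of infinite sets, here real intervals, is zero.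
    refine funext_set (fun k => Complex.ofReal '' Metric.ball (t₀ k) ε) (fun k => ?_) ?_
    · refine Set.Infinite.image Complex.ofReal_injective.injOn ?_
      rw [Real.ball_eq_Ioo]
      exact Set.Ioo_infinite (by linarith)
    · intro x hx
      choose r hr hrx using fun k => hx k (Set.mem_univ k)
      have hrb : r ∈ Metric.ball t₀ ε := by
        rw [Metric.mem_ball, dist_pi_lt_iff hε]
        exact hr
      obtain ⟨h1, h2⟩ := hball r hrb
      have hxr : x = fun k => (r k : ℂ) := funext fun k => (hrx k).symm
      rw [hxr, hev _ fun k => by exact_mod_cast h1 k, h2]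
      simp
  have h1 := hev (fun k => (t k : ℂ)) fun k => (t k).ne_zero
  rw [hG0, map_zero] at h1
  refine (mul_eq_zero.mp h1.symm).resolve_left (pow_ne_zero _ (pow_ne_zero _ ?_))
  exact Finset.prod_ne_zero_iff.mpr fun k _ => (t k).ne_zero

end LatticePolytope

end ToricML

/-! ### Centers and facet functions -/

namespace ToricML

namespace LatticePolytope

open MvPolynomial

variable {d : ℕ} (P : LatticePolytope d) (w : P.LatticePoint → ℝ)

/-- The weighted sum `∑ m, y_m m` of the lattice points, over any ring. -/
noncomputable def center {R : Type*} [CommRing R] (y : P.LatticePoint → R) : Fin d → R :=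
  fun k => ∑ m : P.LatticePoint, y m * (m.1 k : R)

theorem center_eq_sum_smul (y : P.LatticePoint → ℝ) :
    P.center y = ∑ m : P.LatticePoint, y m • intVec m.1 := by
  ext k
  simp [center, intVec]

theorem tau_eq_center (u : P.LatticePoint → ℝ) :
    P.tau u = P.center fun m => u m / ∑ m', u m' := (P.center_eq_sum_smul _).symm

theorem center_ofReal (y : P.LatticePoint → ℝ) :
    P.center (fun m => (y m : ℂ)) = fun k => ((P.center y k : ℝ) : ℂ) := by
  ext k
  simp [center]

variable {P}

theorem Facet.h_center {R : Type*} [CommRing R] (f : P.Facet) {y : P.LatticePoint → R}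
    (hy : ∑ m, y m = 1) : f.h (P.center y) = ∑ m, y m * ((f.h m.1 : ℤ) : R) := by
  simp only [Facet.h, affineForm, center, Int.cast_add, Int.cast_sum, Int.cast_mul, mul_add,
    Finset.sum_add_distrib, ← Finset.sum_mul, hy, one_mul, Int.cast_id]
  simp only [Finset.mul_sum, Finset.sum_mul]
  rw [Finset.sum_comm]
  simp only [mul_assoc]

theorem Facet.h_ofReal (f : P.Facet) (p : Fin d → ℝ) :
    f.h (fun k => (p k : ℂ)) = ((f.h p : ℝ) : ℂ) := by
  simp [Facet.h, affineForm]

theorem Facet.h_intVec (f : P.Facet) (m : Fin d → ℤ) :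
    f.h (intVec m) = ((f.h m : ℤ) : ℝ) := by
  simp [Facet.h, affineForm, intVec]

theorem Facet.h_nonneg (f : P.Facet) (m : P.LatticePoint) : 0 ≤ (f.h m.1 : ℤ) := by
  have := f.2.nonneg _ m.2
  rw [show affineForm f.1.1 f.1.2 (intVec m.1) = ((f.h m.1 : ℤ) : ℝ) from f.h_intVec _] at this
  exact_mod_cast this

theorem Facet.toNat_h (f : P.Facet) (m : P.LatticePoint) :
    (((f.h m.1 : ℤ).toNat : ℕ) : ℤ) = f.h m.1 := Int.toNat_of_nonneg (f.h_nonneg m)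

variable (P)

theorem beta_ofReal (m : P.LatticePoint) (p : Fin d → ℝ) :
    P.beta m (fun k => (p k : ℂ)) = ((P.beta m p : ℝ) : ℂ) := by
  simp [beta, Facet.h_ofReal]

theorem betaW_ofReal (p : Fin d → ℝ) :
    P.betaW w (fun k => (p k : ℂ)) = ((P.betaW w p : ℝ) : ℂ) := by
  simp [betaW, beta_ofReal]

/-! ### Homogeneous forms of the blending equations -/

/-- The degree of `β_m`. -/
noncomputable def betaDegree (m : P.LatticePoint) : ℕ := ∑ f : P.Facet, (f.h m.1).toNat

/-- The homogenization of `y ↦ β_m(∑ y_m m)`, in degree `N`. -/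
noncomputable def betaForm (N : ℕ) (m : P.LatticePoint) : MvPolynomial P.LatticePoint ℂ :=
  (∑ m', X m') ^ (N - P.betaDegree m) *
    ∏ f : P.Facet, (∑ m' : P.LatticePoint, C ((f.h m'.1 : ℤ) : ℂ) * X m') ^ (f.h m.1).toNat

theorem isHomogeneous_betaForm {N : ℕ} {m : P.LatticePoint} (hm : P.betaDegree m ≤ N) :
    (P.betaForm N m).IsHomogeneous N := by
  have h1 : ((∑ m' : P.LatticePoint, X m' : MvPolynomial P.LatticePoint ℂ) ^
      (N - P.betaDegree m)).IsHomogeneous (1 * (N - P.betaDegree m)) :=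
    (IsHomogeneous.sum _ _ 1 fun m' _ => isHomogeneous_X ℂ m').pow _
  have h2 : (∏ f : P.Facet, (∑ m' : P.LatticePoint, C ((f.h m'.1 : ℤ) : ℂ) * X m') ^
      (f.h m.1).toNat).IsHomogeneous (∑ f : P.Facet, 1 * (f.h m.1).toNat) :=
    IsHomogeneous.prod _ _ _ fun f _ =>
      (IsHomogeneous.sum _ _ 1 fun m' _ => isHomogeneous_C_mul_X _ m').pow _
  have h3 := h1.mul h2
  rwa [show 1 * (N - P.betaDegree m) + ∑ f : P.Facet, 1 * (f.h m.1).toNat = N by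
    simp only [one_mul]
    exact Nat.sub_add_cancel hm] at h3

theorem eval_betaForm (N : ℕ) (m : P.LatticePoint) {y : P.LatticePoint → ℂ}
    (hy : ∑ m, y m = 1) : eval y (P.betaForm N m) = P.beta m (P.center y) := by
  simp only [betaForm, beta, map_mul, map_pow, map_sum, map_prod, eval_X, eval_C, hy, one_pow,
    one_mul, Facet.h_center _ hy]
  simp only [mul_comm]

/-- The homogenization of `y ↦ y_m β_w(∑ y_m m) - w_m β_m(∑ y_m m)`. -/
noncomputable def blendingForm (m : P.LatticePoint) : MvPolynomial P.LatticePoint ℂ :=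
  -- The sum of all degrees bounds each of them, so the truncated subtraction in `betaForm` is
  -- exact; the `+ 1` in the second term balances the factor `X m`.
  X m * ∑ m' : P.LatticePoint, C (w m' : ℂ) * P.betaForm (∑ m, P.betaDegree m) m' -
    C (w m : ℂ) * P.betaForm (∑ m, P.betaDegree m + 1) m

theorem isHomogeneous_blendingForm (m : P.LatticePoint) :
    (P.blendingForm w m).IsHomogeneous (∑ m, P.betaDegree m + 1) := by
  have hle : ∀ m, P.betaDegree m ≤ ∑ m, P.betaDegree m := fun m =>
    Finset.single_le_sum (fun _ _ => Nat.zero_le _) (Finset.mem_univ m)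
  refine IsHomogeneous.sub ?_ ?_
  · rw [add_comm]
    exact (isHomogeneous_X ℂ m).mul
      (IsHomogeneous.sum _ _ _ fun m' _ => (P.isHomogeneous_betaForm (hle m')).C_mul _)
  · exact (P.isHomogeneous_betaForm ((hle m).trans (Nat.le_succ _))).C_mul _

theorem eval_blendingForm (m : P.LatticePoint) {y : P.LatticePoint → ℂ} (hy : ∑ m, y m = 1) :
    eval y (P.blendingForm w m) =
      y m * P.betaW w (P.center y) - w m * P.beta m (P.center y) := by
  simp [blendingForm, betaW, P.eval_betaForm _ _ hy]

/-! ### Positivity off the facets and the blending map -/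

theorem nonempty_latticePoint : Nonempty P.LatticePoint := by
  obtain ⟨V, hV⟩ := P.isLattice
  obtain ⟨p, hp⟩ := P.fullDim
  have hp' := interior_subset hp
  rw [hV] at hp'
  obtain ⟨_, m, hm, rfl⟩ := convexHull_nonempty_iff.mp ⟨p, hp'⟩
  exact ⟨m, by rw [hV]; exact subset_convexHull ℝ _ ⟨m, hm, rfl⟩⟩

theorem convex_carrier : Convex ℝ P.carrier := by
  obtain ⟨V, hV⟩ := P.isLattice
  rw [hV]
  exact convex_convexHull ℝ _

theorem center_mem_carrier {y : P.LatticePoint → ℝ} (h0 : ∀ m, 0 ≤ y m) (h1 : ∑ m, y m = 1) :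
    P.center y ∈ P.carrier := by
  rw [center_eq_sum_smul]
  exact P.convex_carrier.sum_mem (fun m _ => h0 m) h1 fun m _ => m.2

theorem h_pos_of_mem_interior {p : Fin d → ℝ} (hp : p ∈ interior P.carrier) (f : P.Facet) :
    0 < f.h p := by
  obtain ⟨q, hq, hq0⟩ := f.2.exists_pos
  have hc : Continuous fun s : ℝ => p + s • (p - q) := by fun_prop
  -- Extend the segment from q slightly beyond p. If h(p) were zero, then h would be negative there,
  -- since h(q) > 0.
  have hev : ∀ᶠ s in nhds (0 : ℝ), p + s • (p - q) ∈ interior P.carrier :=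
    hc.continuousAt.eventually (isOpen_interior.mem_nhds (by simpa using hp))
  obtain ⟨s, hs, hs0⟩ := ((hev.filter_mono nhdsWithin_le_nhds).and
    (self_mem_nhdsWithin : Set.Ioi (0 : ℝ) ∈ nhdsWithin 0 (Set.Ioi 0))).exists
  have h1 := f.2.nonneg _ (interior_subset hs)
  have h2 := f.2.nonneg _ (interior_subset hp)
  change 0 < affineForm _ _ _
  rw [affineForm_eq] at h1 h2 hq0 ⊢
  simp only [map_add, map_smul, map_sub, smul_eq_mul] at h1
  have hs0' : 0 < s := hs0
  nlinarith [mul_pos hs0' hq0]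

/-- A convex combination of the lattice points with positive coefficients lies on no facet. -/
theorem h_center_pos {y : P.LatticePoint → ℝ} (h0 : ∀ m, 0 < y m) (h1 : ∑ m, y m = 1)
    (f : P.Facet) : 0 < f.h (P.center y) := by
  rw [f.h_center h1]
  have hnn : ∀ m : P.LatticePoint, 0 ≤ y m * ((f.h m.1 : ℤ) : ℝ) := fun m =>
    mul_nonneg (h0 m).le (by exact_mod_cast f.h_nonneg m)
  refine lt_of_le_of_ne (Finset.sum_nonneg fun m _ => hnn m) fun hz => ?_
  have hz' := (Finset.sum_eq_zero_iff_of_nonneg fun m _ => hnn m).mp hz.symm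
  obtain ⟨V, hV⟩ := P.isLattice
  -- If the sum vanished, every lattice point, hence every generator of P, would lie on the facet.
  have hface : P.face f.1.1 f.1.2 = P.carrier := by
    rw [P.face_eq_convexHull V hV f.2.nonneg, hV]
    congr 2
    ext m
    refine ⟨fun h => h.1, fun h => ⟨h, ?_⟩⟩
    have hm : intVec m ∈ P.carrier := by
      rw [hV]
      exact subset_convexHull ℝ _ ⟨m, h, rfl⟩
    have h2 := (mul_eq_zero.mp (hz' ⟨m, hm⟩ (Finset.mem_univ _))).resolve_left (h0 _).ne'
    rw [← f.h_intVec] at h2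
    exact h2
  obtain ⟨q, hq, hq0⟩ := f.2.exists_pos
  rw [← hface] at hq
  exact hq0.ne' hq.2

theorem beta_pos (m : P.LatticePoint) {p : Fin d → ℝ} (hp : ∀ f : P.Facet, 0 < f.h p) :
    0 < P.beta m p := Finset.prod_pos fun f _ => pow_pos (hp f) _

variable {w}

theorem betaW_pos (hw : ∀ m, 0 < w m) {p : Fin d → ℝ} (hp : ∀ f : P.Facet, 0 < f.h p) :
    0 < P.betaW w p := by
  have := P.nonempty_latticePoint
  refine Finset.sum_pos (fun m _ => ?_) Finset.univ_nonempty
  exact mul_pos (hw m) (P.beta_pos m hp)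

theorem toricBlending_pos (hw : ∀ m, 0 < w m) {p : Fin d → ℝ} (hp : ∀ f : P.Facet, 0 < f.h p)
    (m : P.LatticePoint) : 0 < P.toricBlending w p m :=
  div_pos (mul_pos (hw m) (P.beta_pos m hp)) (P.betaW_pos hw hp)

theorem sum_toricBlending (hw : ∀ m, 0 < w m) {p : Fin d → ℝ} (hp : ∀ f : P.Facet, 0 < f.h p) :
    ∑ m, P.toricBlending w p m = 1 := by
  simp only [toricBlending]
  rw [← Finset.sum_div]
  exact div_self (P.betaW_pos hw hp).ne'

theorem center_toricBlending (hP : P.StrictLinearPrecision w) {p : Fin d → ℝ}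
    (hp : p ∈ P.carrier) : P.center (P.toricBlending w p) = p := by
  conv_rhs => rw [← hP p hp]
  rw [center_eq_sum_smul, krasauskasMap, Finset.smul_sum]
  refine Finset.sum_congr rfl fun m _ => ?_
  rw [smul_smul, toricBlending]
  simp only [RCLike.ofReal_real_eq_id, id]
  rw [div_eq_inv_mul]

/-! ### The torus parametrization and its inverse, the moment map -/

/-- The torus point `(∏ i, h_i(p) ^ n_ik)_k`. -/
noncomputable def torusPoint (p : Fin d → ℝ) : Fin d → ℝ :=
  fun k => ∏ f : P.Facet, f.h p ^ (f.1.1 k)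

theorem torusPoint_pos {p : Fin d → ℝ} (hp : ∀ f : P.Facet, 0 < f.h p) (k : Fin d) :
    0 < P.torusPoint p k := Finset.prod_pos fun f _ => zpow_pos (hp f) _

/-- Up to a common factor, the `β_m(p)` are the monomials in `torusPoint p`. -/
theorem beta_eq_monomial (m : P.LatticePoint) {p : Fin d → ℝ} (hp : ∀ f : P.Facet, 0 < f.h p) :
    P.beta m p = (∏ f : P.Facet, f.h p ^ f.1.2) * ∏ k, P.torusPoint p k ^ (m.1 k) := by
  simp only [torusPoint, ← Finset.prod_zpow]
  rw [Finset.prod_comm, ← Finset.prod_mul_distrib]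
  refine Finset.prod_congr rfl fun f _ => ?_
  have h1 : ∀ S : Finset (Fin d), ∏ k ∈ S, (f.h p ^ (f.1.1 k)) ^ (m.1 k) =
      f.h p ^ (∑ k ∈ S, m.1 k * f.1.1 k) := by
    classical
    intro S
    induction S using Finset.induction_on with
    | empty => simp
    | insert k S hk ih =>
      rw [Finset.prod_insert hk, Finset.sum_insert hk, zpow_add₀ (hp f).ne', ih, ← zpow_mul,
        mul_comm (f.1.1 k)]
  rw [h1, ← zpow_add₀ (hp f).ne', ← zpow_natCast, f.toNat_h, add_comm]
  simp [Facet.h, affineForm]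

/-- The blending map is a rescaled monomial map. -/
theorem toricBlending_eq_monomial (m : P.LatticePoint) {p : Fin d → ℝ}
    (hp : ∀ f : P.Facet, 0 < f.h p) : P.toricBlending w p m =
      (∏ f : P.Facet, f.h p ^ f.1.2) / P.betaW w p *
        (w m * ∏ k, P.torusPoint p k ^ (m.1 k)) := by
  rw [toricBlending, P.beta_eq_monomial m hp]
  simp only [RCLike.ofReal_real_eq_id, id]
  ring

theorem toricBlending_mem_positivePart (hw : ∀ m, 0 < w m) {p : Fin d → ℝ}
    (hp : ∀ f : P.Facet, 0 < f.h p) :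
    P.toricBlending w p ∈ positivePart (P.veryAffineToric w) := by
  refine ⟨P.toricBlending_pos hw hp, ?_⟩
  have ha : (∏ f : P.Facet, f.h p ^ f.1.2) / P.betaW w p ≠ 0 :=
    (div_pos (Finset.prod_pos fun f _ => zpow_pos (hp f) _) (P.betaW_pos hw hp)).ne'
  refine P.mem_veryAffineToric_of_smul_monomialVec hw ?_ (Complex.ofReal_ne_zero.mpr ha)
    (t := fun k => Units.mk0 (P.torusPoint p k : ℂ)
      (Complex.ofReal_ne_zero.mpr (P.torusPoint_pos hp k).ne')) ?_
  · exact_mod_cast P.sum_toricBlending hw hp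
  · ext m
    rw [P.toricBlending_eq_monomial m hp]
    simp [monomialVec]

/-- The weighted moment map of the real torus. -/
noncomputable def momentMap (w : P.LatticePoint → ℝ) (t : Fin d → ℝ) : Fin d → ℝ :=
  fun k => (∑ m : P.LatticePoint, w m * (∏ l, t l ^ (m.1 l)) * (m.1 k : ℝ)) /
    ∑ m : P.LatticePoint, w m * ∏ l, t l ^ (m.1 l)

/-- The moment map does not see the common factor between the blending point and the monomial vector
of `torusPoint p`. It therefore returns the center of the blending point, which is p by linear
precision. -/
theorem momentMap_torusPoint (hw : ∀ m, 0 < w m) (hP : P.StrictLinearPrecision w)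
    {p : Fin d → ℝ} (hpP : p ∈ P.carrier) (hp : ∀ f : P.Facet, 0 < f.h p) :
    P.momentMap w (P.torusPoint p) = p := by
  conv_rhs => rw [← P.center_toricBlending hP hpP]
  have hA : (∏ f : P.Facet, f.h p ^ f.1.2) ≠ 0 :=
    (Finset.prod_pos fun f _ => zpow_pos (hp f) _).ne'
  have hB : P.betaW w p = (∏ f : P.Facet, f.h p ^ f.1.2) *
      ∑ m : P.LatticePoint, w m * ∏ k, P.torusPoint p k ^ (m.1 k) := by
    simp only [betaW, P.beta_eq_monomial _ hp, Finset.mul_sum]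
    refine Finset.sum_congr rfl fun m _ => ?_
    simp only [RCLike.ofReal_real_eq_id, id]
    ring
  have hB0 := (P.betaW_pos hw hp).ne'
  have hS : ∑ m : P.LatticePoint, w m * ∏ k, P.torusPoint p k ^ (m.1 k) ≠ 0 := by
    intro h0
    rw [h0, mul_zero] at hB
    exact hB0 hB
  ext k
  simp only [momentMap, center, P.toricBlending_eq_monomial _ hp, hB, mul_assoc]
  rw [← Finset.mul_sum]
  field_simp

theorem analyticAt_h (f : P.Facet) (p : Fin d → ℝ) : AnalyticAt ℝ (fun p => f.h p) p := by
  have h1 : (fun p : Fin d → ℝ => f.h p) =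
      fun p => LinearMap.toContinuousLinearMap (linPart f.1.1) p + (f.1.2 : ℝ) :=
    funext fun p => affineForm_eq _ _ p
  rw [h1]
  exact (ContinuousLinearMap.analyticAt _ p).fun_add analyticAt_const

theorem analyticAt_torusPoint {p : Fin d → ℝ} (hp : ∀ f : P.Facet, 0 < f.h p) :
    AnalyticAt ℝ P.torusPoint p := by
  refine analyticAt_pi_iff.mpr fun k => ?_
  exact Finset.analyticAt_fun_prod _ fun f _ => (P.analyticAt_h f p).fun_zpow (hp f).ne'

theorem analyticAt_momentMap (hw : ∀ m, 0 < w m) {t : Fin d → ℝ} (ht : ∀ k, 0 < t k) :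
    AnalyticAt ℝ (P.momentMap w) t := by
  have h1 : ∀ m : P.LatticePoint,
      AnalyticAt ℝ (fun t : Fin d → ℝ => ∏ l, t l ^ (m.1 l)) t := fun m =>
    Finset.analyticAt_fun_prod _ fun l _ =>
      ((ContinuousLinearMap.proj (R := ℝ) (φ := fun _ : Fin d => ℝ) l).analyticAt t).fun_zpow
        (ht l).ne'
  have := P.nonempty_latticePoint
  refine analyticAt_pi_iff.mpr fun k => AnalyticAt.fun_div ?_ ?_ (ne_of_gt ?_)
  · exact Finset.analyticAt_fun_sum _ fun m _ =>
      (analyticAt_const.fun_mul (h1 m)).fun_mul analyticAt_const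
  · exact Finset.analyticAt_fun_sum _ fun m _ => analyticAt_const.fun_mul (h1 m)
  · exact Finset.sum_pos (fun m _ => mul_pos (hw m)
      (Finset.prod_pos fun l _ => zpow_pos (ht l) _)) Finset.univ_nonempty

/-- Strict linear precision makes `torusPoint` an open map at interior points: the moment map is
a left inverse. -/
theorem map_torusPoint_nhds (hw : ∀ m, 0 < w m) (hP : P.StrictLinearPrecision w)
    {p : Fin d → ℝ} (hp : p ∈ interior P.carrier) :
    Filter.map P.torusPoint (nhds p) = nhds (P.torusPoint p) := by
  have hpos := P.h_pos_of_mem_interior hp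
  have hT := (P.analyticAt_torusPoint hpos).hasStrictFDerivAt
  have hM := (P.analyticAt_momentMap hw (P.torusPoint_pos hpos)).hasStrictFDerivAt
  have hcomp := hM.hasFDerivAt.comp p hT.hasFDerivAt
  have hid : (P.momentMap w ∘ P.torusPoint) =ᶠ[nhds p] id :=
    Filter.eventually_of_mem (isOpen_interior.mem_nhds hp) fun q hq =>
      P.momentMap_torusPoint hw hP (interior_subset hq) (P.h_pos_of_mem_interior hq)
  have hcompid := hcomp.unique ((hasFDerivAt_id p).congr_of_eventuallyEq hid)
  -- The derivative has a left inverse, namely the derivative of the moment map. It is therefore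
  -- injective, and surjective because source and target have the same dimension.
  refine hT.map_nhds_eq_of_surj (LinearMap.range_eq_top.mpr ?_)
  refine LinearMap.injective_iff_surjective.mp fun v v' hv => ?_
  have h1 := congrArg (fun L => L v) hcompid
  have h2 := congrArg (fun L => L v') hcompid
  simp only [ContinuousLinearMap.comp_apply, ContinuousLinearMap.id_apply] at h1 h2
  rw [← h1, ← h2]
  exact congrArg _ hv

theorem toricBlending_mul_betaW (hw : ∀ m, 0 < w m) {p : Fin d → ℝ}
    (hp : ∀ f : P.Facet, 0 < f.h p) (m : P.LatticePoint) :
    P.toricBlending w p m * P.betaW w p = w m * P.beta m p :=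
  div_mul_cancel₀ _ (P.betaW_pos hw hp).ne'

/-- At a blending point the center is p again, so the equation there is the definition of the
blending map. Torus points near `torusPoint p₀` are all of this kind up to scaling, and density
extends the equation to the complex torus. -/
theorem eval_blendingForm_monomialVec (hw : ∀ m, 0 < w m) (hP : P.StrictLinearPrecision w)
    (m : P.LatticePoint) (t : Fin d → ℂˣ) :
    eval (P.monomialVec w t) (P.blendingForm w m) = 0 := by
  obtain ⟨p₀, hp₀⟩ := P.fullDim
  refine P.eval_monomialVec_eq_zero_of_real w (P.isHomogeneous_blendingForm w m)
    (t₀ := P.torusPoint p₀) ?_ t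
  rw [← P.map_torusPoint_nhds hw hP hp₀, Filter.eventually_map]
  filter_upwards [isOpen_interior.mem_nhds hp₀] with p hpi
  have hp := P.h_pos_of_mem_interior hpi
  refine ⟨fun k => (P.torusPoint_pos hp k).ne', ?_⟩
  set A : ℝ := (∏ f : P.Facet, f.h p ^ f.1.2) / P.betaW w p with hA
  have hA0 : A ≠ 0 :=
    (div_pos (Finset.prod_pos fun f _ => zpow_pos (hp f) _) (P.betaW_pos hw hp)).ne'
  have h1 : (fun m : P.LatticePoint => (w m : ℂ) * ∏ k, (P.torusPoint p k : ℂ) ^ (m.1 k)) =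
      ((A⁻¹ : ℝ) : ℂ) • fun m => ((P.toricBlending w p m : ℝ) : ℂ) := by
    ext m
    simp only [Pi.smul_apply, smul_eq_mul]
    rw [P.toricBlending_eq_monomial m hp, ← hA]
    simp only [← Complex.ofReal_mul, inv_mul_cancel_left₀ hA0]
    simp
  have hsum : ∑ m, ((P.toricBlending w p m : ℝ) : ℂ) = 1 := by
    exact_mod_cast P.sum_toricBlending hw hp
  rw [h1, eval_smul_of_isHomogeneous (P.isHomogeneous_blendingForm w m),
    P.eval_blendingForm w m hsum, P.center_ofReal,
    P.center_toricBlending hP (interior_subset hpi), betaW_ofReal, beta_ofReal]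
  have h2 := P.toricBlending_mul_betaW hw hp m
  rw [← Complex.ofReal_mul, h2]
  simp

/-- Points of the very affine variety satisfy the blending equations at their centers. -/
theorem mul_betaW_center (hw : ∀ m, 0 < w m) (hP : P.StrictLinearPrecision w)
    {y : P.LatticePoint → ℂ} (hy : y ∈ P.veryAffineToric w) (m : P.LatticePoint) :
    y m * P.betaW w (P.center y) = w m * P.beta m (P.center y) := by
  obtain ⟨-, hS, hv⟩ := (P.mem_veryAffineToric_iff hw).mp hy
  have h1 := hv _ _ (P.isHomogeneous_blendingForm w m)
    (P.eval_blendingForm_monomialVec hw hP m)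
  rw [P.eval_blendingForm w m hS] at h1
  exact sub_eq_zero.mp h1

/-- A point of the very affine variety with real center off the facets is in the image of the
blending map. -/
theorem eq_toricBlending_of_center_eq (hw : ∀ m, 0 < w m) (hP : P.StrictLinearPrecision w)
    {y : P.LatticePoint → ℂ} (hy : y ∈ P.veryAffineToric w) {p : Fin d → ℝ}
    (hp : ∀ f : P.Facet, 0 < f.h p) (hc : P.center y = fun k => (p k : ℂ)) :
    y = fun m => ((P.toricBlending w p m : ℝ) : ℂ) := by
  ext m
  have h1 := P.mul_betaW_center hw hP hy m
  have hB : ((P.betaW w p : ℝ) : ℂ) ≠ 0 := Complex.ofReal_ne_zero.mpr (P.betaW_pos hw hp).ne'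
  rw [hc, betaW_ofReal, beta_ofReal] at h1
  rw [toricBlending, eq_comm]
  push_cast
  rw [div_eq_iff hB, h1]
  rfl

end LatticePolytope

end ToricML

/-! ### Tangent vectors and critical points -/

namespace ToricML

namespace LatticePolytope

open MvPolynomial

variable {d : ℕ} (P : LatticePolytope d) {w : P.LatticePoint → ℝ}

/-- Affine functions of the lattice points have the same average for all coefficients with the
same center. -/
theorem sum_mul_affine_eq {R : Type*} [CommRing R] {y y' : P.LatticePoint → R}
    (hy : ∑ m, y m = 1) (hy' : ∑ m, y' m = 1) (hc : P.center y = P.center y') (a : R)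
    (g : P.Facet → R) :
    ∑ m : P.LatticePoint, y m * ((∑ f : P.Facet, ((f.h m.1 : ℤ) : R) * g f) + a) =
      ∑ m : P.LatticePoint, y' m * ((∑ f : P.Facet, ((f.h m.1 : ℤ) : R) * g f) + a) := by
  have h1 : ∀ {x : P.LatticePoint → R}, ∑ m, x m = 1 →
      ∑ m : P.LatticePoint, x m * ((∑ f : P.Facet, ((f.h m.1 : ℤ) : R) * g f) + a) =
        (∑ f : P.Facet, f.h (P.center x) * g f) + a := by
    intro x hx
    simp only [mul_add, Finset.sum_add_distrib, ← Finset.sum_mul, hx, one_mul,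
      Facet.h_center _ hx]
    simp only [Finset.mul_sum, Finset.sum_mul]
    rw [Finset.sum_comm]
    simp only [mul_assoc]
  rw [h1 hy, h1 hy', hc]

/-- The tangent vectors coming from the torus action. -/
theorem isTangent_torus (hw : ∀ m, 0 < w m) {y : P.LatticePoint → ℂ}
    (hy : y ∈ P.veryAffineToric w) (k : Fin d) :
    IsTangent (P.veryAffineToric w) y
      (fun m : P.LatticePoint => y m * ((m.1 k : ℂ) - P.center y k)) := by
  have hS := ((P.mem_veryAffineToric_iff hw).mp hy).2.1
  -- Move y by the one-parameter subgroup exp(s) in the k-th torus coordinate and renormalize to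
  -- coordinate sum one; the derivative of the normalizing sum is the k-th coordinate of the center.
  have h1 : ∀ m : P.LatticePoint, HasDerivAt (fun s : ℂ => y m * Complex.exp s ^ (m.1 k))
      (y m * (m.1 k : ℂ)) 0 := by
    intro m
    have : (fun s : ℂ => y m * Complex.exp s ^ (m.1 k)) =
        fun s : ℂ => y m * Complex.exp ((m.1 k : ℂ) * s) := by
      ext s
      rw [Complex.exp_int_mul]
    rw [this]
    have h2 := (((hasDerivAt_id (0 : ℂ)).const_mul (m.1 k : ℂ)).cexp).const_mul (y m)
    simpa using h2
  have h2 : HasDerivAt (fun s : ℂ => ∑ m : P.LatticePoint, y m * Complex.exp s ^ (m.1 k))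
      (P.center y k) 0 := HasDerivAt.fun_sum fun m _ => h1 m
  have hS0 : ∑ m : P.LatticePoint, y m * Complex.exp 0 ^ (m.1 k) = 1 := by simpa using hS
  have hne : ∀ᶠ s in nhds (0 : ℂ), ∑ m : P.LatticePoint, y m * Complex.exp s ^ (m.1 k) ≠ 0 :=
    h2.continuousAt.eventually_ne (by rw [hS0]; exact one_ne_zero)
  have h3 := isTangent_of_hasDerivAt (Y := P.veryAffineToric w) (s := 0)
    (c := fun s m => y m * Complex.exp s ^ (m.1 k) /
      ∑ m' : P.LatticePoint, y m' * Complex.exp s ^ (m'.1 k))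
    (v := fun m => y m * ((m.1 k : ℂ) - P.center y k)) (fun m => by
      refine ((h1 m).fun_div h2 (by rw [hS0]; exact one_ne_zero)).congr_deriv ?_
      rw [hS0]
      simp
      ring)
    (hne.mono fun s hs => P.torus_smul_mem_veryAffineToric hw hy k
      (Units.mk0 (Complex.exp s) (Complex.exp_ne_zero s)) hs)
  simpa [hS] using h3

/-- The likelihood equations: critical points have the center of the data. -/
theorem center_eq_of_isCriticalPoint (hw : ∀ m, 0 < w m) {u : P.LatticePoint → ℕ}
    (hu : ∀ m, 0 < u m) {y : P.LatticePoint → ℂ}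
    (hy : IsCriticalPoint (P.veryAffineToric w) u y) :
    P.center y = fun k =>
      ((P.center (fun m => (u m : ℝ) / ∑ m', (u m' : ℝ)) k : ℝ) : ℂ) := by
  have := P.nonempty_latticePoint
  have hne := ((P.mem_veryAffineToric_iff hw).mp hy.1).1
  have hU : (∑ m, (u m : ℂ)) ≠ 0 := by
    have : 0 < ∑ m, u m := Finset.sum_pos (fun m _ => hu m) Finset.univ_nonempty
    exact_mod_cast this.ne'
  ext k
  -- In this direction the logarithmic derivatives are m_k - c(y)_k, so criticality says that ∑ u_m
  -- (m_k - c(y)_k) = 0.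
  have h1 := hy.2 _ (P.isTangent_torus hw hy.1 k)
  rw [polyDifferential_monomial u hne] at h1
  have h2 := (mul_eq_zero.mp h1).resolve_left
    (Finset.prod_ne_zero_iff.mpr fun m _ => pow_ne_zero _ (hne m))
  have h3 : ∀ m : P.LatticePoint, y m * ((m.1 k : ℂ) - P.center y k) / y m =
      (m.1 k : ℂ) - P.center y k := fun m => mul_div_cancel_left₀ _ (hne m)
  simp only [h3] at h2
  simp only [mul_sub, Finset.sum_sub_distrib, ← Finset.sum_mul] at h2
  have h4 : ((P.center (fun m => (u m : ℝ) / ∑ m', (u m' : ℝ)) k : ℝ) : ℂ) =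
      (∑ m : P.LatticePoint, (u m : ℂ) * (m.1 k : ℂ)) / ∑ m, (u m : ℂ) := by
    simp only [center, Complex.ofReal_sum, Finset.sum_div]
    refine Finset.sum_congr rfl fun m _ => ?_
    push_cast
    ring
  rw [h4, eq_div_iff hU]
  linear_combination -h2

/-- Logarithmic derivatives of the `β_m` along lines in the hyperplane of coordinate sum one. -/
theorem hasDerivAt_beta_center {y v : P.LatticePoint → ℂ} (hS : ∑ m, y m = 1)
    (hv0 : ∑ m, v m = 0) (hh : ∀ f : P.Facet, f.h (P.center y) ≠ 0) (m : P.LatticePoint) :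
    HasDerivAt (fun s : ℂ => P.beta m (P.center (y + s • v)))
      (P.beta m (P.center y) * ∑ f : P.Facet, ((f.h m.1 : ℤ) : ℂ) *
        ((∑ m : P.LatticePoint, v m * ((f.h m.1 : ℤ) : ℂ)) / f.h (P.center y))) 0 := by
  have hline : ∀ s : ℂ, ∑ m, (y + s • v) m = 1 := fun s => by
    simp [Finset.sum_add_distrib, ← Finset.mul_sum, hS, hv0]
  have hc : ∀ m, HasDerivAt (fun s : ℂ => (y + s • v) m) (v m) 0 := fun m => by
    simpa using ((hasDerivAt_id (0 : ℂ)).mul_const (v m)).const_add (y m)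
  have h1 := hasDerivAt_prod_pow Finset.univ (s := 0)
    (f := fun (f : P.Facet) (s : ℂ) => f.h (P.center (y + s • v)))
    (g := fun f : P.Facet =>
      (∑ m : P.LatticePoint, v m * ((f.h m.1 : ℤ) : ℂ)) / f.h (P.center y))
    (fun f => (f.h m.1).toNat) fun f _ => by
      have h2 : (fun s : ℂ => f.h (P.center (y + s • v))) =
          fun s : ℂ => ∑ m : P.LatticePoint, (y + s • v) m * ((f.h m.1 : ℤ) : ℂ) :=
        funext fun s => f.h_center (hline s)
      rw [h2]
      refine (HasDerivAt.fun_sum fun m _ => (hc m).mul_const _).congr_deriv ?_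
      rw [zero_smul, add_zero, mul_div_cancel₀ _ (hh f)]
  have h3 : ∀ f : P.Facet, (((f.h m.1 : ℤ).toNat : ℕ) : ℂ) = ((f.h m.1 : ℤ) : ℂ) := fun f => by
    exact_mod_cast congrArg (Int.cast : ℤ → ℂ) (f.toNat_h m)
  simp only [zero_smul, add_zero, h3] at h1
  exact h1

/-- At a point off the facets, tangent vectors divided by the coordinates are affine functions of
the lattice points. -/
theorem exists_affine_of_isTangent (hw : ∀ m, 0 < w m) (hP : P.StrictLinearPrecision w)
    {y v : P.LatticePoint → ℂ} (hy : y ∈ P.veryAffineToric w)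
    (hB : P.betaW w (P.center y) ≠ 0) (hh : ∀ f : P.Facet, f.h (P.center y) ≠ 0)
    (hv : IsTangent (P.veryAffineToric w) y v) :
    ∑ m, v m = 0 ∧ ∃ (g : P.Facet → ℂ) (a : ℂ), ∀ m : P.LatticePoint,
      v m / y m = (∑ f : P.Facet, ((f.h m.1 : ℤ) : ℂ) * g f) + a := by
  classical
  obtain ⟨hne, hS, -⟩ := (P.mem_veryAffineToric_iff hw).mp hy
  have hv0 : ∑ m, v m = 0 := by
    have h1 := hv (∑ m, X m - 1) fun z hz => by
      simp [((P.mem_veryAffineToric_iff hw).mp hz).2.1]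
    simpa [polyDifferential, pderiv_X, Pi.single_apply] using h1
  refine ⟨hv0, ?_⟩
  have hline : ∀ s : ℂ, ∑ m, (y + s • v) m = 1 := fun s => by
    simp [Finset.sum_add_distrib, ← Finset.mul_sum, hS, hv0]
  have hc : ∀ m, HasDerivAt (fun s : ℂ => (y + s • v) m) (v m) 0 := fun m => by
    simpa using ((hasDerivAt_id (0 : ℂ)).mul_const (v m)).const_add (y m)
  set g : P.Facet → ℂ := fun f =>
    (∑ m : P.LatticePoint, v m * ((f.h m.1 : ℤ) : ℂ)) / f.h (P.center y)
  have hβ := P.hasDerivAt_beta_center hS hv0 hh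
  set B' := ∑ m : P.LatticePoint, (w m : ℂ) *
    (P.beta m (P.center y) * ∑ f : P.Facet, ((f.h m.1 : ℤ) : ℂ) * g f)
  have hBd : HasDerivAt (fun s : ℂ => P.betaW w (P.center (y + s • v))) B' 0 :=
    HasDerivAt.fun_sum fun m _ => (hβ m).const_mul (w m : ℂ)
  -- On Y, y_m = w_m β_m / β_w at the center. The function g comes from the logarithmic derivative
  -- of β_m, and the constant is minus that of β_w.
  refine ⟨g, -(B' / P.betaW w (P.center y)), fun m => ?_⟩
  have hF : polyDifferential (P.blendingForm w m) y v = 0 := hv _ fun z hz => by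
    rw [P.eval_blendingForm w m ((P.mem_veryAffineToric_iff hw).mp hz).2.1,
      P.mul_betaW_center hw hP hz, sub_self]
  -- The line y + s v need not lie in Y, but it keeps coordinate sum one, so the form can be
  -- replaced by its dehomogenized expression along it.
  have h1 : HasDerivAt (fun s : ℂ => eval (y + s • v) (P.blendingForm w m)) 0 0 := by
    have := hasDerivAt_eval_comp (P.blendingForm w m) hc
    rwa [zero_smul, add_zero, hF] at this
  simp only [P.eval_blendingForm w m (hline _)] at h1
  have h3 := h1.unique (((hc m).fun_mul hBd).fun_sub ((hβ m).const_mul (w m : ℂ)))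
  rw [zero_smul, add_zero] at h3
  have h4 := P.mul_betaW_center hw hP hy m
  have := hne m
  rw [← mul_assoc, ← h4] at h3
  field_simp
  linear_combination -h3

/-- The likelihood function has exactly one complex critical point. -/
theorem isCriticalPoint_iff (hw : ∀ m, 0 < w m) (hP : P.StrictLinearPrecision w)
    {u : P.LatticePoint → ℕ} (hu : ∀ m, 0 < u m) (y : P.LatticePoint → ℂ) :
    IsCriticalPoint (P.veryAffineToric w) u y ↔ y = fun m =>
      ((P.toricBlending w (P.center fun m => (u m : ℝ) / ∑ m', (u m' : ℝ)) m : ℝ) : ℂ) := by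
  have := P.nonempty_latticePoint
  have hU : 0 < ∑ m, (u m : ℝ) :=
    Finset.sum_pos (fun m _ => by exact_mod_cast hu m) Finset.univ_nonempty
  have hpos : ∀ m, 0 < (u m : ℝ) / ∑ m', (u m' : ℝ) := fun m =>
    div_pos (by exact_mod_cast hu m) hU
  have hsum : ∑ m, (u m : ℝ) / ∑ m', (u m' : ℝ) = 1 := by
    rw [← Finset.sum_div, div_self hU.ne']
  set p := P.center fun m => (u m : ℝ) / ∑ m', (u m' : ℝ) with hp
  have hh : ∀ f : P.Facet, 0 < f.h p := P.h_center_pos hpos hsum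
  have hpP : p ∈ P.carrier := P.center_mem_carrier (fun m => (hpos m).le) hsum
  constructor
  · intro hy
    exact P.eq_toricBlending_of_center_eq hw hP hy.1 hh (P.center_eq_of_isCriticalPoint hw hu hy)
  · rintro rfl
    have hyY := (P.toricBlending_mem_positivePart hw hh).2
    refine ⟨hyY, fun v hv => ?_⟩
    obtain ⟨hne, hS, -⟩ := (P.mem_veryAffineToric_iff hw).mp hyY
    have hcy : P.center (fun m => ((P.toricBlending w p m : ℝ) : ℂ)) = fun k => (p k : ℂ) := by
      rw [center_ofReal, P.center_toricBlending hP hpP]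
    have hcu : P.center (fun m => (((u m : ℝ) / ∑ m', (u m' : ℝ) : ℝ) : ℂ)) =
        fun k => (p k : ℂ) := P.center_ofReal _
    obtain ⟨hv0, g, a, hga⟩ := P.exists_affine_of_isTangent hw hP hyY
      (by rw [hcy, betaW_ofReal]; exact_mod_cast (P.betaW_pos hw hh).ne')
      (fun f => by rw [hcy, f.h_ofReal]; exact_mod_cast (hh f).ne') hv
    rw [polyDifferential_monomial u hne]
    -- The weights u/u_+ and y have the same center p, so the average of v_m / y_m for u/u_+ is ∑
    -- v_m = 0.
    have h1 := P.sum_mul_affine_eq (by exact_mod_cast hsum) hS (hcu.trans hcy.symm) a g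
    simp only [← hga] at h1
    have h2 : ∀ m, ((P.toricBlending w p m : ℝ) : ℂ) *
        (v m / ((P.toricBlending w p m : ℝ) : ℂ)) = v m := fun m => mul_div_cancel₀ _ (hne m)
    simp only [h2, hv0] at h1
    have h3 : ∑ m, (u m : ℂ) * (v m / ((P.toricBlending w p m : ℝ) : ℂ)) =
        (∑ m, (u m : ℂ)) * ∑ m, (((u m : ℝ) / ∑ m', (u m' : ℝ) : ℝ) : ℂ) *
          (v m / ((P.toricBlending w p m : ℝ) : ℂ)) := by
      rw [Finset.mul_sum]
      refine Finset.sum_congr rfl fun m _ => ?_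
      have : (∑ m, (u m : ℂ)) ≠ 0 := by exact_mod_cast hU.ne'
      push_cast
      field_simp
    rw [h3, h1, mul_zero, mul_zero]

/-! ### Positive points and the maximum of the likelihood -/

/-- Positive points of the very affine variety are in the image of the blending map. -/
theorem eq_toricBlending_center (hw : ∀ m, 0 < w m) (hP : P.StrictLinearPrecision w)
    {z : P.LatticePoint → ℝ} (hz : z ∈ positivePart (P.veryAffineToric w)) :
    ∑ m, z m = 1 ∧ (∀ f : P.Facet, 0 < f.h (P.center z)) ∧
      z = P.toricBlending w (P.center z) := by
  have hS : ∑ m, z m = 1 := by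
    exact_mod_cast ((P.mem_veryAffineToric_iff hw).mp hz.2).2.1
  have hh := P.h_center_pos hz.1 hS
  refine ⟨hS, hh, funext fun m => ?_⟩
  have h1 := P.eq_toricBlending_of_center_eq hw hP hz.2 hh (P.center_ofReal z)
  exact_mod_cast congrFun h1 m

/-- Apart from the term log w_m, which cancels when two blending points are compared, this is affine
in the lattice point m. -/
theorem log_toricBlending (hw : ∀ m, 0 < w m) {p : Fin d → ℝ} (hp : ∀ f : P.Facet, 0 < f.h p)
    (m : P.LatticePoint) : Real.log (P.toricBlending w p m) = Real.log (w m) +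
      (∑ f : P.Facet, ((f.h m.1 : ℤ) : ℝ) * Real.log (f.h p)) - Real.log (P.betaW w p) := by
  have hβ := P.beta_pos m hp
  change Real.log (w m * P.beta m p / P.betaW w p) = _
  rw [Real.log_div (mul_pos (hw m) hβ).ne' (P.betaW_pos hw hp).ne',
    Real.log_mul (hw m).ne' hβ.ne', beta, Real.log_prod fun f _ => (pow_pos (hp f) _).ne']
  congr 2
  refine Finset.sum_congr rfl fun f _ => ?_
  rw [Real.log_pow]
  congr 1
  exact_mod_cast congrArg (Int.cast : ℤ → ℝ) (f.toNat_h m)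

/-- The log-likelihood has a strict maximum at the blending point of the center of the data. -/
theorem sum_mul_log_lt (hw : ∀ m, 0 < w m) (hP : P.StrictLinearPrecision w)
    {u : P.LatticePoint → ℝ} (hu : ∀ m, 0 < u m) (hS : ∑ m, u m = 1)
    {z : P.LatticePoint → ℝ} (hz : z ∈ positivePart (P.veryAffineToric w))
    (hne : z ≠ P.toricBlending w (P.center u)) :
    ∑ m, u m * Real.log (z m) <
      ∑ m, u m * Real.log (P.toricBlending w (P.center u) m) := by
  obtain ⟨hzS, hzh, hz'⟩ := P.eq_toricBlending_center hw hP hz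
  have hh := P.h_center_pos hu hS
  have hx0 := P.toricBlending_pos hw hh
  have hxS := P.sum_toricBlending hw hh
  have hxc := P.center_toricBlending hP (P.center_mem_carrier (fun m => (hu m).le) hS)
  set x := P.toricBlending w (P.center u) with hx
  have haff : ∀ m : P.LatticePoint, Real.log (z m) - Real.log (x m) =
      (∑ f : P.Facet, ((f.h m.1 : ℤ) : ℝ) *
        (Real.log (f.h (P.center z)) - Real.log (f.h (P.center u)))) +
      (Real.log (P.betaW w (P.center u)) - Real.log (P.betaW w (P.center z))) := by
    intro m
    rw [congrFun hz' m, hx, P.log_toricBlending hw hzh, P.log_toricBlending hw hh]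
    simp only [mul_sub, Finset.sum_sub_distrib]
    ring
  -- The center of x is that of u, so u may be replaced by x in averages of affine functions; what
  -- remains is minus a relative entropy.
  have h1 : ∑ m, u m * (Real.log (z m) - Real.log (x m)) =
      ∑ m, x m * (Real.log (z m) - Real.log (x m)) := by
    simp only [haff]
    exact P.sum_mul_affine_eq hS hxS hxc.symm _ _
  -- Gibbs' inequality: log r ≤ r - 1 at r = z_m / x_m, strict where z and x differ. The right-hand
  -- side is 1 - 1 = 0.
  have h2 : ∑ m, x m * (Real.log (z m) - Real.log (x m)) < ∑ m, (z m - x m) := by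
    have hterm : ∀ m, x m * (z m / x m - 1) = z m - x m := fun m => by
      have := (hx0 m).ne'
      field_simp
    obtain ⟨m₀, hm₀⟩ := Function.ne_iff.mp hne
    refine Finset.sum_lt_sum (fun m _ => ?_) ⟨m₀, Finset.mem_univ _, ?_⟩
    · rw [← Real.log_div (hz.1 m).ne' (hx0 m).ne', ← hterm]
      exact mul_le_mul_of_nonneg_left (Real.log_le_sub_one_of_pos (div_pos (hz.1 m) (hx0 m)))
        (hx0 m).le
    · rw [← Real.log_div (hz.1 m₀).ne' (hx0 m₀).ne', ← hterm]
      refine mul_lt_mul_of_pos_left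
        (Real.log_lt_sub_one_of_pos (div_pos (hz.1 m₀) (hx0 m₀)) fun h => hm₀ ?_) (hx0 m₀)
      exact (div_eq_one_iff_eq (hx0 m₀).ne').mp h
  rw [Finset.sum_sub_distrib, hzS, hxS, sub_self, ← h1] at h2
  simp only [mul_sub, Finset.sum_sub_distrib] at h2
  linarith

end LatticePolytope

theorem likelihood_eq_exp {ι : Type*} [Fintype ι] (u : ι → ℝ) {x : ι → ℝ} (hx : ∀ j, 0 < x j) :
    likelihood u x = Real.exp (∑ j, u j * Real.log (x j)) := by
  rw [likelihood, Real.exp_sum]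
  refine Finset.prod_congr rfl fun j _ => ?_
  rw [Real.rpow_def_of_pos (hx j), mul_comm]

end ToricML

theorem corollary5p4 {d : ℕ} (P : ToricML.LatticePolytope d) (w : P.LatticePoint → ℝ)
    (hw : ∀ m, 0 < w m) (hP : P.StrictLinearPrecision w) :
    ToricML.HasMLDegree (P.veryAffineToric w) 1 ∧
    ∀ u : P.LatticePoint → ℝ, (∀ m, 0 < u m) →
      ∀ x : P.LatticePoint → ℝ,
        ToricML.IsMLEstimate (P.veryAffineToric w) u x ↔ x = P.toricBlending w (P.tau u) := by
  -- The constant polynomial 1 excludes nothing: every positive integer u has exactly one critical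
  -- point.
  refine ⟨⟨1, one_ne_zero, fun u hu _ => ?_⟩, fun u hu x => ?_⟩
  · rw [Nat.cast_one, Set.encard_eq_one]
    exact ⟨_, Set.ext fun y => P.isCriticalPoint_iff hw hP hu y⟩
  · have := P.nonempty_latticePoint
    have hU : 0 < ∑ m, u m := Finset.sum_pos (fun m _ => hu m) Finset.univ_nonempty
    have hpos : ∀ m, 0 < u m / ∑ m', u m' := fun m => div_pos (hu m) hU
    have hsum : ∑ m, u m / ∑ m', u m' = 1 := by rw [← Finset.sum_div, div_self hU.ne']
    have hmem := P.toricBlending_mem_positivePart hw (P.h_center_pos hpos hsum)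
    rw [P.tau_eq_center]
    constructor
    · rintro ⟨hx, hmax⟩
      by_contra hne
      have h1 := hmax _ hmem
      rw [ToricML.likelihood_eq_exp _ hmem.1, ToricML.likelihood_eq_exp _ hx.1,
        Real.exp_le_exp] at h1
      exact absurd h1 (not_le.mpr (P.sum_mul_log_lt hw hP hpos hsum hx hne))
    · rintro rfl
      refine ⟨hmem, fun z hz => ?_⟩
      rw [ToricML.likelihood_eq_exp _ hmem.1, ToricML.likelihood_eq_exp _ hz.1, Real.exp_le_exp]
      by_cases hne : z = P.toricBlending w (P.center fun m => u m / ∑ m', u m')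
      · rw [← hne]
      · exact (P.sum_mul_log_lt hw hP hpos hsum hz hne).le
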